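/- Let $n\ge 0$ be an integer, let $\lambda$ be a Young diagram with $n$ cells, and let $d_\lambda$ be the dimension of the corresponding irreducible complex representation of the symmetric group $S_n$ (the Specht module of $\lambda$, i.e. the left ideal $\mathbb{C}[S_n]c_T$ generated by the Young symmetrizer $c_T$ of a tableau $T$ of shape $\lambda$). Call this representation *big* if $$d_\lambda > e^{-\sqrt{n}\,\log n}\,\sqrt{n!}\,,$$ where $\log$ is the natural logarithm and $\sqrt{n}\,\log n$ is read as $0$ for $n=0$. If it is big, then the width of $\lambda$ (the length of its first row) and the height of $\lambda$ (the length of its first column) are both less than $4\sqrt{n}\,\log n$. -/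

import Mathlib

noncomputable section

/-- A Young tableau of shape `μ` with entries `0, …, n - 1`, given by the cell in which each entry
stands. Such a tableau exists exactly when `μ` has `n` cells. -/
abbrev YoungTableau (n : ℕ) (μ : YoungDiagram) : Type :=
  Fin n ≃ {c : ℕ × ℕ // c ∈ μ.cells}

namespace YoungTableau

variable {n : ℕ} {μ : YoungDiagram}

/-- The permutations that keep every entry of the tableau in its row
(the row of a cell is its first coordinate). -/
def rowGroup (T : YoungTableau n μ) : Subgroup (Equiv.Perm (Fin n)) where
  carrier := {σ | ∀ i, (T (σ i)).1.1 = (T i).1.1}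
  one_mem' := fun _ => rfl
  mul_mem' := fun {a b} ha hb i => (ha (b i)).trans (hb i)
  inv_mem' := fun {a} ha i => by
    have h := ha (a⁻¹ i)
    rw [← Equiv.Perm.mul_apply, mul_inv_cancel, Equiv.Perm.one_apply] at h
    exact h.symm

/-- The permutations that keep every entry of the tableau in its column
(the column of a cell is its second coordinate). -/
def colGroup (T : YoungTableau n μ) : Subgroup (Equiv.Perm (Fin n)) where
  carrier := {σ | ∀ i, (T (σ i)).1.2 = (T i).1.2}
  one_mem' := fun _ => rfl
  mul_mem' := fun {a b} ha hb i => (ha (b i)).trans (hb i)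
  inv_mem' := fun {a} ha i => by
    have h := ha (a⁻¹ i)
    rw [← Equiv.Perm.mul_apply, mul_inv_cancel, Equiv.Perm.one_apply] at h
    exact h.symm

open Classical in
/-- The Young symmetrizer `(∑ p) (∑ sgn(q) q)` of a tableau, where `p` runs through the row group
and `q` through the column group. -/
def symmetrizer (T : YoungTableau n μ) : MonoidAlgebra ℂ (Equiv.Perm (Fin n)) :=
  (∑ p : T.rowGroup, MonoidAlgebra.of ℂ (Equiv.Perm (Fin n)) p) *
    ∑ q : T.colGroup, ((Equiv.Perm.sign (q : Equiv.Perm (Fin n)) : ℤ) : ℂ) •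
      MonoidAlgebra.of ℂ (Equiv.Perm (Fin n)) q

/-- The Specht module of a tableau: the left ideal of the group algebra `ℂ[S_n]` generated by the
Young symmetrizer. Up to isomorphism it depends only on the shape. -/
abbrev spechtModule (T : YoungTableau n μ) : Ideal (MonoidAlgebra ℂ (Equiv.Perm (Fin n))) :=
  Ideal.span {T.symmetrizer}

end YoungTableau

/-- `ρ` is (a copy of) the irreducible representation of `S_n` that corresponds to the Young
diagram `μ`: it is isomorphic to the Specht module of a tableau of shape `μ` (so `μ` has `n`
cells). -/
def IsIrrepOfShape {n : ℕ} {V : Type*} [AddCommGroup V] [Module ℂ V]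
    (ρ : Representation ℂ (Equiv.Perm (Fin n)) V) (μ : YoungDiagram) : Prop :=
  ∃ T : YoungTableau n μ,
    Nonempty (ρ.asModule ≃ₗ[MonoidAlgebra ℂ (Equiv.Perm (Fin n))] T.spechtModule)

/-- A representation of `S_n` is big if its dimension exceeds `e^{-√n log n} √(n!)`. -/
def IsBig {n : ℕ} {V : Type*} [AddCommGroup V] [Module ℂ V]
    (_ρ : Representation ℂ (Equiv.Perm (Fin n)) V) : Prop :=
  Real.exp (-(√(n : ℝ) * Real.log n)) * √(n.factorial : ℝ) < (Module.finrank ℂ V : ℝ)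

end

/-! Let `r` be the length of the first row or column, and let `S_r` permute its entries. The Specht
module contains a nonzero vector on which `S_r` acts trivially (row) or by sign (column). The
eigenvectors for this character form a space stable under the commuting `S_{n-r}`. A simple
`S_{n-r}`-submodule `U` has dimension at most `√(n-r)!` and is stable under `S_r × S_{n-r}`, so by
irreducibility its translates, one per `r`-subset, span everything: `d_λ ≤ (n choose r) √(n-r)! ≤
√n! · √n^r / r!`. Since `r! ≥ (r/e)^r`, taking `r ≥ 4√n log n` contradicts bigness. Irreducibility
of the Specht module follows from von Neumann's lemma: with `a` the row sum and `b` the alternating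
column sum, `a ℂ[S_n] b` is the line through `ab`. -/

open scoped MonoidAlgebra

/-! ### Dimension bounds from eigenvectors of a smaller symmetric group -/

/-- The square of the dimension of a simple module over a finite-dimensional algebra over an
algebraically closed field is at most the dimension of the algebra. -/
theorem IsSimpleModule.finrank_sq_le_finrank (k A V : Type*) [Field k] [IsAlgClosed k] [Ring A]
    [Algebra k A] [FiniteDimensional k A] [AddCommGroup V] [Module k V] [Module A V]
    [IsScalarTower k A V] [IsSimpleModule A V] [FiniteDimensional k V] :
    Module.finrank k V ^ 2 ≤ Module.finrank k A := by
  have hsurj : Function.Surjective (Algebra.lsmul k k V : A →ₐ[k] Module.End k V).toLinearMap := by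
    intro f
    -- By Schur's lemma `End_A V` consists of scalars, so every `k`-linear map commutes with it and
    -- the density theorem applies.
    let f' : Module.End (Module.End A V) V :=
      { f with
        map_smul' := fun φ v => by
          obtain ⟨c, rfl⟩ :=
            (IsSimpleModule.algebraMap_end_bijective_of_isAlgClosed (A := A) (V := V) k).2 φ
          exact f.map_smul c v }
    obtain ⟨s, hs⟩ := Module.Finite.fg_top (R := k) (M := V)
    obtain ⟨a, ha⟩ := jacobson_density f' s
    refine ⟨a, LinearMap.ext_on hs fun v hv => ?_⟩
    exact (ha v hv).symm
  have h := LinearMap.finrank_le_finrank_of_surjective hsurj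
  rwa [Module.finrank_linearMap, ← sq] at h

namespace Representation

variable {α V : Type*} [Fintype α] [DecidableEq α] [AddCommGroup V] [Module ℂ V]

/-- If a representation of a symmetric group contains a vector on which the permutations supported
in `s` act by a character, then it contains such vectors forming a space of dimension at most
`√(n - |s|)!` which is invariant under the permutations fixing `s` pointwise. -/
theorem exists_small_invariant_eigenspace (ρ : Representation ℂ (Equiv.Perm α) V)
    [FiniteDimensional ℂ V] (s : Finset α) (χ : Equiv.Perm α → ℂ) {v : V} (hv0 : v ≠ 0)
    (hv : ∀ σ : Equiv.Perm α, (∀ x ∉ s, σ x = x) → ρ σ v = χ σ • v) :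
    ∃ U : Submodule ℂ V, U ≠ ⊥ ∧
      Module.finrank ℂ U ^ 2 ≤ (Fintype.card α - s.card).factorial ∧
      (∀ σ : Equiv.Perm α, (∀ x ∉ s, σ x = x) → ∀ u ∈ U, ρ σ u = χ σ • u) ∧
      ∀ τ : Equiv.Perm α, (∀ x ∈ s, τ x = x) → ∀ u ∈ U, ρ τ u ∈ U := by
  let ι : Equiv.Perm {x // x ∉ s} →* Equiv.Perm α := Equiv.Perm.ofSubtype
  let ρ' : Representation ℂ (Equiv.Perm {x // x ∉ s}) V := ρ.comp ι
  have hcomm : ∀ (σ : Equiv.Perm α), (∀ x ∉ s, σ x = x) → ∀ k, σ * ι k = ι k * σ := by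
    intro σ hσ k
    refine Equiv.Perm.Disjoint.commute fun x => ?_
    by_cases hx : x ∈ s
    · exact Or.inr (Equiv.Perm.ofSubtype_apply_of_not_mem k (by simpa using hx))
    · exact Or.inl (hσ x hx)
  let X : Subrepresentation ρ' :=
    { toSubmodule :=
        { carrier := {w | ∀ σ : Equiv.Perm α, (∀ x ∉ s, σ x = x) → ρ σ w = χ σ • w}
          zero_mem' := fun σ _ => by simp
          add_mem' := fun {a b} ha hb σ hσ => by rw [map_add, ha σ hσ, hb σ hσ, smul_add]
          smul_mem' := fun c a ha σ hσ => by rw [map_smul, ha σ hσ, smul_comm] }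
      apply_mem_toSubmodule := fun k w hw σ hσ => by
        change ρ σ (ρ (ι k) w) = χ σ • ρ (ι k) w
        rw [← Module.End.mul_apply, ← map_mul, hcomm σ hσ, map_mul, Module.End.mul_apply,
          hw σ hσ, map_smul] }
  have hX : X.asSubmodule ≠ ⊥ := by
    intro h
    exact hv0 ((Submodule.eq_bot_iff _).1 h v hv)
  obtain ⟨S, hSX, hS⟩ := (IsSemisimpleModule.eq_bot_or_exists_simple_le X.asSubmodule).resolve_left hX
  let U := (Subrepresentation.ofSubmodule' S).toSubmodule
  refine ⟨U, ?_, ?_, fun σ hσ u hu => hSX hu σ hσ, fun τ hτ u hu => ?_⟩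
  · intro h
    have hnt : Nontrivial S := IsSimpleModule.nontrivial ℂ[Equiv.Perm {x // x ∉ s}] S
    obtain ⟨⟨x, hx⟩, hx0⟩ := exists_ne (0 : S)
    have : x ∈ U := hx
    rw [h] at this
    exact hx0 (Subtype.ext ((Submodule.mem_bot ℂ).1 this))
  · have : FiniteDimensional ℂ ρ'.asModule := inferInstanceAs (FiniteDimensional ℂ V)
    have : FiniteDimensional ℂ S := inferInstanceAs (FiniteDimensional ℂ U)
    have h := IsSimpleModule.finrank_sq_le_finrank ℂ ℂ[Equiv.Perm {x // x ∉ s}] S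
    have h2 : Module.finrank ℂ ℂ[Equiv.Perm {x // x ∉ s}] = (Fintype.card α - s.card).factorial := by
      rw [(MonoidAlgebra.coeffLinearEquiv ℂ).finrank_eq, Module.finrank_finsupp_self,
        Fintype.card_perm, Fintype.card_subtype_compl, Fintype.card_coe]
    rw [h2] at h
    exact h
  · have h : ι (τ.subtypePerm fun x => by
        refine not_congr ⟨fun h => ?_, fun h => by rwa [hτ x h]⟩
        rwa [← τ.injective (hτ _ h)]) = τ :=
      Equiv.Perm.ofSubtype_subtypePerm _ fun x hx hxs => hx (hτ x hxs)
    rw [← h]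
    exact (Subrepresentation.ofSubmodule' S).apply_mem_toSubmodule _ hu

/-- An irreducible representation of the symmetric group on `n` letters containing a vector on
which the permutations of an `r`-element set act by a character has dimension at most
`(n choose r) √(n - r)!`. -/
theorem IsIrreducible.finrank_le_choose_mul_sqrt (ρ : Representation ℂ (Equiv.Perm α) V)
    [ρ.IsIrreducible] [FiniteDimensional ℂ V] (s : Finset α) (χ : Equiv.Perm α → ℂ) {v : V}
    (hv0 : v ≠ 0) (hv : ∀ σ : Equiv.Perm α, (∀ x ∉ s, σ x = x) → ρ σ v = χ σ • v) :
    (Module.finrank ℂ V : ℝ) ≤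
      (Fintype.card α).choose s.card * √((Fintype.card α - s.card).factorial : ℝ) := by
  obtain ⟨U, hU0, hUdim, hUs, hUc⟩ := ρ.exists_small_invariant_eigenspace s χ hv0 hv
  have hstab : ∀ h : Equiv.Perm α, s.map h.toEmbedding = s → ∀ u ∈ U, ρ h u ∈ U := by
    intro h hs u hu
    have hiff : ∀ x, h x ∈ s ↔ x ∈ s := fun x => by
      conv_lhs => rw [← hs]
      simp
    let σ := Equiv.Perm.ofSubtype (h.subtypePerm hiff)
    have hσ : ∀ x ∉ s, σ x = x := fun x hx => Equiv.Perm.ofSubtype_apply_of_not_mem _ hx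
    have hσ' : ∀ x ∈ s, σ x = h x := fun x hx => by
      simp [σ, Equiv.Perm.ofSubtype_apply_of_mem (h.subtypePerm hiff) hx]
    have hτ : ∀ x ∈ s, (h * σ⁻¹) x = x := by
      intro x hx
      obtain ⟨y, rfl⟩ := h.surjective x
      have hy := (hiff y).1 hx
      rw [← hσ' y hy, ← Equiv.Perm.mul_apply, inv_mul_cancel_right, hσ' y hy]
    -- Here `h = (hσ⁻¹)σ`; applying `hσ⁻¹` to `χ σ • u = ρ σ u` avoids dividing by `χ σ`.
    have := hUc (h * σ⁻¹) hτ _ (U.smul_mem (χ σ) hu)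
    rw [← hUs σ hσ u hu, ← Module.End.mul_apply, ← map_mul, inv_mul_cancel_right] at this
    exact this
  have hex : ∀ t : Finset.powersetCard s.card (Finset.univ : Finset α),
      ∃ g : Equiv.Perm α, s.map g.toEmbedding = t := by
    rintro ⟨t, ht⟩
    have hcard := (Finset.mem_powersetCard.1 ht).2
    let e : {x // x ∈ s} ≃ {x // x ∈ t} := Finset.equivOfCardEq hcard.symm
    refine ⟨e.extendSubtype, Finset.eq_of_subset_of_card_le (fun x hx => ?_) (by simp [hcard])⟩
    obtain ⟨y, hy, rfl⟩ := Finset.mem_map.1 hx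
    exact e.extendSubtype_mem y hy
  choose g hg using hex
  let Φ : (Finset.powersetCard s.card (Finset.univ : Finset α) → U) →ₗ[ℂ] V :=
    ∑ t, (ρ (g t)).comp (U.subtype.comp (LinearMap.proj t))
  have hmem : ∀ (h : Equiv.Perm α), ∀ u ∈ U, ρ h u ∈ LinearMap.range Φ := by
    intro h u hu
    let t : Finset.powersetCard s.card (Finset.univ : Finset α) :=
      ⟨s.map h.toEmbedding, by simp⟩
    have hu' : ρ ((g t)⁻¹ * h) u ∈ U := by
      refine hstab _ ?_ u hu
      have : s.map h.toEmbedding = s.map (g t).toEmbedding := (hg t).symm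
      have hmul : ((g t)⁻¹ * h).toEmbedding = h.toEmbedding.trans (g t).symm.toEmbedding := rfl
      rw [hmul, ← Finset.map_map, this, Finset.map_map]
      ext x
      simp
    refine ⟨Pi.single t ⟨_, hu'⟩, ?_⟩
    simp only [Φ, LinearMap.sum_apply, LinearMap.comp_apply, LinearMap.proj_apply,
      Submodule.subtype_apply]
    rw [Finset.sum_eq_single t]
    · rw [Pi.single_eq_same, ← Module.End.mul_apply, ← map_mul, mul_inv_cancel_left]
    · intro b _ hb
      rw [Pi.single_eq_of_ne hb]
      simp
    · simp
  let R : Subrepresentation ρ :=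
    { toSubmodule := LinearMap.range Φ
      apply_mem_toSubmodule := by
        rintro h _ ⟨w, rfl⟩
        simp only [Φ, LinearMap.sum_apply, LinearMap.comp_apply, LinearMap.proj_apply,
          Submodule.subtype_apply, map_sum]
        refine Submodule.sum_mem _ fun t _ => ?_
        rw [← Module.End.mul_apply, ← map_mul]
        exact hmem _ _ (w t).2 }
  have hR : R = ⊤ := by
    refine (eq_bot_or_eq_top R).resolve_left fun h => hU0 ?_
    refine (Submodule.eq_bot_iff _).2 fun u hu => ?_
    have h1 : u ∈ R := by simpa using! hmem 1 u hu
    rw [h] at h1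
    exact h1
  have hsurj : Function.Surjective Φ :=
    LinearMap.range_eq_top.1 (congrArg Subrepresentation.toSubmodule hR)
  have h1 := LinearMap.finrank_le_finrank_of_surjective hsurj
  rw [Module.finrank_pi_fintype, Finset.sum_const, Finset.card_univ, Fintype.card_coe,
    Finset.card_powersetCard, Finset.card_univ, smul_eq_mul] at h1
  have h2 : (Module.finrank ℂ U : ℝ) ≤ √((Fintype.card α - s.card).factorial : ℝ) :=
    Real.le_sqrt_of_sq_le (by exact_mod_cast hUdim)
  calc (Module.finrank ℂ V : ℝ) ≤ (Fintype.card α).choose s.card * Module.finrank ℂ U := by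
        exact_mod_cast h1
    _ ≤ _ := by gcongr

end Representation

/-! ### Numerical estimates -/

/-- After squaring and clearing `r!`, this is `n! · n(n-1)⋯(n-r+1) ≤ n! · n^r`. -/
theorem choose_mul_sqrt_factorial_le {n r : ℕ} (hr : r ≤ n) :
    n.choose r * √((n - r).factorial : ℝ) ≤ √(n.factorial : ℝ) * (√(n : ℝ) ^ r / r.factorial) := by
  have hr0 : (0 : ℝ) < r.factorial := by positivity
  have hnr : (0 : ℝ) < (n - r).factorial := by positivity
  have h1 : (n.choose r : ℝ) * r.factorial * (n - r).factorial = n.factorial := by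
    exact_mod_cast Nat.choose_mul_factorial_mul_factorial hr
  have h2 : (n.choose r : ℝ) * r.factorial ≤ (n : ℝ) ^ r := by
    rw [mul_comm]
    exact_mod_cast (Nat.descFactorial_eq_factorial_mul_choose n r) ▸ Nat.descFactorial_le_pow n r
  rw [← mul_div_assoc, le_div_iff₀ hr0]
  refine le_of_pow_le_pow_left₀ two_ne_zero (by positivity) ?_
  rw [mul_pow, mul_pow, mul_pow, Real.sq_sqrt hnr.le, Real.sq_sqrt (by positivity), pow_right_comm,
    Real.sq_sqrt (by positivity)]
  calc (n.choose r : ℝ) ^ 2 * (n - r).factorial * r.factorial ^ 2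
      = (n.choose r * r.factorial * (n - r).factorial) * (n.choose r * r.factorial) := by ring
    _ ≤ n.factorial * n ^ r := by rw [h1]; gcongr

theorem lt_of_exp_neg_mul_sqrt_factorial_lt {n r : ℕ} (hr : r ≤ n)
    (h : Real.exp (-(√(n : ℝ) * Real.log n)) * √(n.factorial : ℝ) <
      n.choose r * √((n - r).factorial : ℝ)) :
    (r : ℝ) < 4 * √(n : ℝ) * Real.log n := by
  -- For `n ≤ 1` the hypothesis is false; for `n = 2` already `r ≤ 2 < 4√2 log 2`. From `n = 3` on,
  -- `log n ≥ 1`.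
  obtain rfl | rfl | rfl | hn : n = 0 ∨ n = 1 ∨ n = 2 ∨ 3 ≤ n := by omega
  · obtain rfl : r = 0 := by omega
    simp at h
  · obtain rfl | rfl : r = 0 ∨ r = 1 := by omega
    all_goals simp at h
  · have h1 : (r : ℝ) ≤ 2 := by exact_mod_cast hr
    have h2 : (1 : ℝ) ≤ √2 := Real.one_le_sqrt.2 (by norm_num)
    have h3 := Real.log_two_gt_d9
    push_cast
    nlinarith
  · by_contra! hle
    have hlog : 1 ≤ Real.log n := by
      rw [Real.le_log_iff_exp_le (by positivity)]
      exact Real.exp_one_lt_three.le.trans (by exact_mod_cast hn)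
    have hsq : 0 < √(n : ℝ) := Real.sqrt_pos.2 (by positivity)
    have hr4 : 4 * √(n : ℝ) ≤ r := by nlinarith
    have hrpos : (0 : ℝ) < r := by linarith
    have hfac : (r : ℝ) ^ r / r.factorial ≤ Real.exp 1 ^ r := by
      rw [← Real.exp_nat_mul, mul_one]
      exact Real.pow_div_factorial_le_exp _ hrpos.le r
    have hquart : √(n : ℝ) / r * Real.exp 1 ≤ Real.exp (-(1 / 4)) := by
      -- `e^5 < 3^5 = 243 < 256 = 4^4`.
      have h5 : Real.exp (5 / 4) ≤ 4 := by
        refine le_of_pow_le_pow_left₀ (n := 4) (by norm_num) (by norm_num) ?_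
        rw [← Real.exp_nat_mul]
        have : Real.exp ((4 : ℕ) * (5 / 4)) = Real.exp 1 ^ 5 := by
          rw [← Real.exp_nat_mul]; norm_num
        rw [this]
        calc Real.exp 1 ^ 5 ≤ 3 ^ 5 := by gcongr; exact Real.exp_one_lt_three.le
          _ ≤ 4 ^ 4 := by norm_num
      have h6 : Real.exp 1 = Real.exp (5 / 4) * Real.exp (-(1 / 4)) := by
        rw [← Real.exp_add]; norm_num
      have h7 : √(n : ℝ) / r ≤ 1 / 4 := by rw [div_le_iff₀ hrpos]; linarith
      have h8 := Real.exp_pos (-(1 / 4))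
      rw [h6, ← mul_assoc]
      have : √(n : ℝ) / r * Real.exp (5 / 4) ≤ 1 / 4 * 4 := by gcongr
      nlinarith
    have hmain : √(n : ℝ) ^ r / r.factorial ≤ Real.exp (-(√(n : ℝ) * Real.log n)) := by
      calc √(n : ℝ) ^ r / r.factorial
          = (√(n : ℝ) / r) ^ r * ((r : ℝ) ^ r / r.factorial) := by
            rw [div_pow]; field_simp
        _ ≤ (√(n : ℝ) / r) ^ r * Real.exp 1 ^ r := by gcongr
        _ = (√(n : ℝ) / r * Real.exp 1) ^ r := by rw [mul_pow]
        _ ≤ Real.exp (-(1 / 4)) ^ r := by gcongr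
        _ = Real.exp (-(r / 4)) := by rw [← Real.exp_nat_mul]; ring_nf
        _ ≤ _ := by gcongr; linarith
    refine absurd h (not_lt.2 ?_)
    refine (choose_mul_sqrt_factorial_le hr).trans ?_
    rw [mul_comm]
    gcongr

/-! ### Young symmetrizers and simplicity of the Specht module -/

/-- `M` uniquely collects all nonnegative weights, so exchanging cells for ones outside `M` strictly
lowers the sum. -/
theorem Finset.subset_of_sum_eq_sum {ι : Type*} {A M : Finset ι} {w : ι → ℤ}
    (hpos : ∀ c ∈ M, 0 ≤ w c) (hneg : ∀ c ∉ M, w c < 0) (h : ∑ c ∈ A, w c = ∑ c ∈ M, w c) :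
    A ⊆ M := by
  classical
  rw [← Finset.sdiff_eq_empty_iff_subset]
  by_contra hne
  have h1 : ∑ c ∈ A \ M, w c < 0 :=
    Finset.sum_neg (fun c hc => hneg c (Finset.mem_sdiff.1 hc).2)
      (Finset.nonempty_iff_ne_empty.2 hne)
  have h2 : 0 ≤ ∑ c ∈ M \ A, w c :=
    Finset.sum_nonneg fun c hc => hpos c (Finset.mem_sdiff.1 hc).1
  have h3 := Finset.sum_sdiff_sub_sum_sdiff (s₁ := A) (s₂ := M) (f := w)
  omega

/-- A nonzero left ideal of a semisimple ring has nonzero square. -/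
theorem Ideal.exists_mul_ne_zero {R : Type*} [Ring R] [IsSemisimpleRing R] {I : Ideal R}
    (hI : I ≠ ⊥) : ∃ x ∈ I, ∃ y ∈ I, x * y ≠ 0 := by
  obtain ⟨J, hJ⟩ := exists_isCompl I
  obtain ⟨x, hx, hx0⟩ := Submodule.exists_mem_ne_zero_of_ne_bot hI
  obtain ⟨e, he, f, hf, hef⟩ := Submodule.mem_sup.1
    (hJ.sup_eq_top ▸ Submodule.mem_top : (1 : R) ∈ I ⊔ J)
  refine ⟨x, hx, e, he, fun h => hx0 ?_⟩
  have hxf : x = x * f := by rw [← zero_add (x * f), ← h, ← mul_add, hef, mul_one]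
  exact (Submodule.mem_bot R).1 (hJ.inf_eq_bot ▸ ⟨hx, hxf ▸ J.smul_mem x hf⟩)

namespace YoungTableau

variable {n : ℕ} {μ : YoungDiagram} (T : YoungTableau n μ)

/-- If entries sharing a row of `T` never share a column of `g • T`, then the cells given by the row
in `T` and the column in `g • T` of an entry belong to the diagram. -/
theorem mem_cells_of_injective (g : Equiv.Perm (Fin n))
    (h : Function.Injective fun x => ((T x).1.1, (T (g⁻¹ x)).1.2)) (x : Fin n) :
    ((T x).1.1, (T (g⁻¹ x)).1.2) ∈ μ.cells := by
  classical
  let F : Fin n → ℕ × ℕ := fun x => ((T x).1.1, (T (g⁻¹ x)).1.2)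
  -- The hook length, extended to all cells: positive inside the diagram and negative outside. It is
  -- a function of the row plus a function of the column, so its sum depends only on how many cells
  -- lie in each row and column.
  let w : ℕ × ℕ → ℤ := fun c => ((μ.rowLen c.1 : ℤ) - c.1) + ((μ.colLen c.2 : ℤ) - c.2 - 1)
  have hsum : ∑ c ∈ Finset.univ.image F, w c = ∑ c ∈ μ.cells, w c := by
    rw [Finset.sum_image (fun a _ b _ hab => h hab), ← Finset.sum_coe_sort μ.cells,
      ← T.sum_comp]
    simp only [w, Finset.sum_add_distrib]
    congr 1
    exact Equiv.sum_comp g⁻¹ fun y => ((μ.colLen (T y).1.2 : ℤ) - (T y).1.2 - 1)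
  refine Finset.subset_of_sum_eq_sum (w := w) ?_ ?_ hsum
    (Finset.mem_image_of_mem F (Finset.mem_univ x))
  · rintro ⟨i, j⟩ hc
    have h1 := YoungDiagram.mem_iff_lt_rowLen.1 ((YoungDiagram.mem_cells _).1 hc)
    have h2 := YoungDiagram.mem_iff_lt_colLen.1 ((YoungDiagram.mem_cells _).1 hc)
    simp only [w]
    omega
  · rintro ⟨i, j⟩ hc
    have h1 := mt YoungDiagram.mem_iff_lt_rowLen.2 (mt (YoungDiagram.mem_cells _).2 hc)
    have h2 := mt YoungDiagram.mem_iff_lt_colLen.2 (mt (YoungDiagram.mem_cells _).2 hc)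
    simp only [w]
    omega

/-- Von Neumann's lemma: if entries sharing a row of `T` never share a column of `g • T`, then `g`
is the product of a row and a column permutation. -/
theorem exists_mul_eq_of_injective (g : Equiv.Perm (Fin n))
    (h : Function.Injective fun x => ((T x).1.1, (T (g⁻¹ x)).1.2)) :
    ∃ p ∈ T.rowGroup, ∃ q ∈ T.colGroup, p * q = g := by
  let S : Fin n → {c : ℕ × ℕ // c ∈ μ.cells} := fun x => ⟨_, T.mem_cells_of_injective g h x⟩
  have hinj : Function.Injective (T.symm ∘ S) := T.symm.injective.comp fun x y hxy =>
    h (congrArg Subtype.val hxy)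
  -- `p` moves each entry within its row of `T` to its column in `g • T`; hence `p * g` preserves
  -- the columns of `T`.
  let p : Equiv.Perm (Fin n) := Equiv.ofBijective _ (Finite.injective_iff_bijective.1 hinj)
  have hp : ∀ x, T (p x) = S x := fun x => T.apply_symm_apply (S x)
  refine ⟨p⁻¹, T.rowGroup.inv_mem fun x => by rw [hp], p * g, fun x => ?_, inv_mul_cancel_left p g⟩
  rw [Equiv.Perm.mul_apply, hp]
  simp [S]

open Classical in
/-- The sum of the row permutations. -/
noncomputable def rowSum : ℂ[Equiv.Perm (Fin n)] :=
  ∑ p : T.rowGroup, MonoidAlgebra.of ℂ (Equiv.Perm (Fin n)) p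

open Classical in
/-- The alternating sum of the column permutations. -/
noncomputable def colAltSum : ℂ[Equiv.Perm (Fin n)] :=
  ∑ q : T.colGroup, ((Equiv.Perm.sign (q : Equiv.Perm (Fin n)) : ℤ) : ℂ) •
      MonoidAlgebra.of ℂ (Equiv.Perm (Fin n)) q

theorem symmetrizer_eq : T.symmetrizer = T.rowSum * T.colAltSum := rfl

variable {T}

theorem of_mul_rowSum {p : Equiv.Perm (Fin n)} (hp : p ∈ T.rowGroup) :
    MonoidAlgebra.of ℂ _ p * T.rowSum = T.rowSum := by
  classical
  rw [rowSum, Finset.mul_sum]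
  refine Fintype.sum_equiv (Equiv.mulLeft ⟨p, hp⟩) _ _ fun x => ?_
  simp

theorem rowSum_mul_of {p : Equiv.Perm (Fin n)} (hp : p ∈ T.rowGroup) :
    T.rowSum * MonoidAlgebra.of ℂ _ p = T.rowSum := by
  classical
  rw [rowSum, Finset.sum_mul]
  refine Fintype.sum_equiv (Equiv.mulRight ⟨p, hp⟩) _ _ fun x => ?_
  simp

theorem of_mul_colAltSum {q : Equiv.Perm (Fin n)} (hq : q ∈ T.colGroup) :
    MonoidAlgebra.of ℂ _ q * T.colAltSum =
      ((Equiv.Perm.sign q : ℤ) : ℂ) • T.colAltSum := by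
  classical
  rw [colAltSum, Finset.mul_sum, Finset.smul_sum]
  refine Fintype.sum_equiv (Equiv.mulLeft ⟨q, hq⟩) _ _ fun x => ?_
  have h1 : ((Equiv.Perm.sign q : ℤ) : ℂ) * ((Equiv.Perm.sign q : ℤ) : ℂ) = 1 := by
    rw [← Int.cast_mul, ← Units.val_mul, Int.units_mul_self]
    simp
  rw [smul_smul, mul_smul_comm, ← map_mul]
  simp only [Equiv.coe_mulLeft, Subgroup.coe_mul, Equiv.Perm.sign_mul, Units.val_mul, Int.cast_mul]
  rw [← mul_assoc, h1, one_mul]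

variable (T)

theorem symmetrizer_ne_zero : T.symmetrizer ≠ 0 := by
  classical
  intro h
  -- The row and column groups meet trivially, so only `1 * 1` contributes.
  have h1 : T.symmetrizer.coeff 1 = 1 := by
    have hterm : ∀ (p : T.rowGroup) (q : T.colGroup),
        (MonoidAlgebra.of ℂ (Equiv.Perm (Fin n)) p *
          (((Equiv.Perm.sign (q : Equiv.Perm (Fin n)) : ℤ) : ℂ) •
            MonoidAlgebra.of ℂ (Equiv.Perm (Fin n)) q)).coeff 1 =
        if p = 1 ∧ q = 1 then 1 else 0 := by
      intro p q
      rw [mul_smul_comm, ← map_mul, MonoidAlgebra.of_apply]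
      simp only [MonoidAlgebra.coeff_smul, MonoidAlgebra.coeff_single, Finsupp.smul_apply,
        Finsupp.single_apply, smul_eq_mul]
      by_cases hpq : (p : Equiv.Perm (Fin n)) * q = 1
      · have hq : q = 1 := by
          ext1
          refine Equiv.ext fun x => T.injective (Subtype.ext (Prod.ext ?_ (q.2 x)))
          have := p.2 ((q : Equiv.Perm (Fin n)) x)
          rw [← Equiv.Perm.mul_apply, hpq] at this
          exact this.symm
        have hp : p = 1 := by
          ext1
          simpa [hq] using hpq
        simp [hp, hq]
      · have : ¬ (p = 1 ∧ q = 1) := by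
          rintro ⟨rfl, rfl⟩
          simp at hpq
        simp [hpq, this]
    rw [symmetrizer_eq, rowSum, colAltSum, Finset.sum_mul_sum]
    simp only [MonoidAlgebra.coeff_sum, Finsupp.finsetSum_apply, hterm]
    simp [ite_and]
  rw [h] at h1
  simp at h1

/-- The space `a ℂ[S_n] b` is spanned by the Young symmetrizer `a b`. -/
theorem rowSum_mul_mul_colAltSum_mem_span (x : ℂ[Equiv.Perm (Fin n)]) :
    T.rowSum * x * T.colAltSum ∈ Submodule.span ℂ {T.symmetrizer} := by
  induction x using MonoidAlgebra.induction_linear with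
  | zero => simp
  | add x y hx hy => rw [mul_add, add_mul]; exact add_mem hx hy
  | single g c =>
    have hc : MonoidAlgebra.single g c = c • MonoidAlgebra.of ℂ (Equiv.Perm (Fin n)) g := by
      simp [MonoidAlgebra.of_apply]
    rw [hc, mul_smul_comm, smul_mul_assoc]
    refine Submodule.smul_mem _ c ?_
    by_cases h : Function.Injective fun x => ((T x).1.1, (T (g⁻¹ x)).1.2)
    · obtain ⟨p, hp, q, hq, rfl⟩ := T.exists_mul_eq_of_injective g h
      rw [map_mul, ← mul_assoc, rowSum_mul_of hp, mul_assoc, of_mul_colAltSum hq, mul_smul_comm]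
      exact Submodule.smul_mem _ _ (Submodule.mem_span_singleton_self _)
    -- The transposition `t` of `x`, `y` is a row permutation and `t' = g⁻¹tg` a column one, so `agb
    -- = atgb = agt'b = -agb`.
    · obtain ⟨x, y, hxy, hne⟩ := Function.not_injective_iff.1 h
      rw [Prod.mk.injEq] at hxy
      have ht : Equiv.swap x y ∈ T.rowGroup := fun z => by
        by_cases hzx : z = x
        · rw [hzx, Equiv.swap_apply_left, hxy.1]
        by_cases hzy : z = y
        · rw [hzy, Equiv.swap_apply_right, hxy.1]
        rw [Equiv.swap_apply_of_ne_of_ne hzx hzy]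
      have ht' : Equiv.swap (g⁻¹ x) (g⁻¹ y) ∈ T.colGroup := fun z => by
        by_cases hzx : z = g⁻¹ x
        · rw [hzx, Equiv.swap_apply_left, hxy.2]
        by_cases hzy : z = g⁻¹ y
        · rw [hzy, Equiv.swap_apply_right, hxy.2]
        rw [Equiv.swap_apply_of_ne_of_ne hzx hzy]
      have hcomm : Equiv.swap x y * g = g * Equiv.swap (g⁻¹ x) (g⁻¹ y) := by
        rw [Equiv.mul_swap_eq_swap_mul]
        simp
      have hsign : Equiv.Perm.sign (Equiv.swap (g⁻¹ x) (g⁻¹ y)) = -1 :=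
        Equiv.Perm.sign_swap fun he => hne (g⁻¹.injective he)
      have hneg : T.rowSum * MonoidAlgebra.of ℂ _ g * T.colAltSum =
          -(T.rowSum * MonoidAlgebra.of ℂ _ g * T.colAltSum) := by
        conv_lhs => rw [← rowSum_mul_of ht, mul_assoc T.rowSum, ← map_mul, hcomm, map_mul,
          ← mul_assoc, mul_assoc _ _ T.colAltSum, of_mul_colAltSum ht', hsign]
        simp
      have : IsAddTorsionFree ℂ[Equiv.Perm (Fin n)] := .of_module_rat _
      rw [self_eq_neg.1 hneg]
      exact zero_mem _

theorem exists_symmetrizer_mul_mul_eq_smul (x : ℂ[Equiv.Perm (Fin n)]) :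
    ∃ c : ℂ, T.symmetrizer * x * T.symmetrizer = c • T.symmetrizer := by
  obtain ⟨c, hc⟩ := Submodule.mem_span_singleton.1
    (T.rowSum_mul_mul_colAltSum_mem_span (T.colAltSum * x * T.rowSum))
  refine ⟨c, ?_⟩
  rw [hc]
  simp only [symmetrizer_eq, mul_assoc]

/-- Semisimplicity gives a nonzero product in `U`. For its right factor `z * T.symmetrizer`, left
multiplication by `T.symmetrizer` yields a nonzero multiple of `T.symmetrizer`. -/
theorem symmetrizer_mem_of_le {U : Ideal ℂ[Equiv.Perm (Fin n)]} (hU : U ≤ T.spechtModule)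
    (hU0 : U ≠ ⊥) : T.symmetrizer ∈ U := by
  obtain ⟨u, hu, u', hu', huu⟩ := Ideal.exists_mul_ne_zero hU0
  obtain ⟨y, rfl⟩ := Ideal.mem_span_singleton'.1 (hU hu)
  obtain ⟨z, rfl⟩ := Ideal.mem_span_singleton'.1 (hU hu')
  obtain ⟨c, hc⟩ := T.exists_symmetrizer_mul_mul_eq_smul z
  rw [mul_assoc y, ← mul_assoc T.symmetrizer, hc] at huu
  have hc0 : c ≠ 0 := by
    rintro rfl
    simp at huu
  have hmem : c⁻¹ • (T.symmetrizer * (z * T.symmetrizer)) ∈ U :=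
    Submodule.smul_of_tower_mem U _ (U.mul_mem_left _ hu')
  rwa [← mul_assoc, hc, smul_smul, inv_mul_cancel₀ hc0, one_smul] at hmem

theorem isSimpleModule_spechtModule :
    IsSimpleModule ℂ[Equiv.Perm (Fin n)] T.spechtModule := by
  rw [isSimpleModule_iff_isAtom]
  refine ⟨?_, fun U hU => ?_⟩
  · rw [Ne, Ideal.span_singleton_eq_bot]
    exact T.symmetrizer_ne_zero
  · by_contra hU0
    exact hU.not_ge ((Ideal.span_singleton_le_iff_mem _).2 (T.symmetrizer_mem_of_le hU.le hU0))

theorem exists_rowGroup_fixed :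
    ∃ v : T.spechtModule, v ≠ 0 ∧
      ∀ p ∈ T.rowGroup, MonoidAlgebra.of ℂ (Equiv.Perm (Fin n)) p • v = v := by
  refine ⟨⟨T.symmetrizer, Ideal.mem_span_singleton_self _⟩, ?_, fun p hp => Subtype.ext ?_⟩
  · exact fun h => T.symmetrizer_ne_zero (congrArg Subtype.val h)
  · change MonoidAlgebra.of ℂ _ p * T.symmetrizer = T.symmetrizer
    rw [symmetrizer_eq, ← mul_assoc, of_mul_rowSum hp]

/-- The symmetrizer has the row sum on its left, so it need not transform by sign. Instead `b * v`
is used, with `v` in the ideal chosen so that `y * a * b * v ≠ 0` for some `y`. -/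
theorem exists_colGroup_sign :
    ∃ v : T.spechtModule, v ≠ 0 ∧
      ∀ q ∈ T.colGroup, MonoidAlgebra.of ℂ (Equiv.Perm (Fin n)) q • v =
        ((Equiv.Perm.sign q : ℤ) : ℂ) • v := by
  have h0 : T.spechtModule ≠ ⊥ := by
    rw [Ne, Ideal.span_singleton_eq_bot]
    exact T.symmetrizer_ne_zero
  obtain ⟨u, hu, v, hv, huv⟩ := Ideal.exists_mul_ne_zero h0
  obtain ⟨y, rfl⟩ := Ideal.mem_span_singleton'.1 hu
  refine ⟨⟨T.colAltSum * v, Ideal.mul_mem_left _ _ hv⟩, fun h => huv ?_, fun q hq => Subtype.ext ?_⟩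
  · have h1 : T.colAltSum * v = 0 := congrArg Subtype.val h
    rw [symmetrizer_eq, ← mul_assoc, mul_assoc, h1, mul_zero]
  · change MonoidAlgebra.of ℂ _ q * (T.colAltSum * v) =
      ((Equiv.Perm.sign q : ℤ) : ℂ) • (T.colAltSum * v)
    rw [← mul_assoc, of_mul_colAltSum hq, smul_mul_assoc]

/-- The entries in the first row. -/
def firstRow : Finset (Fin n) := Finset.univ.filter fun x => (T x).1.1 = 0

/-- The entries in the first column. -/
def firstCol : Finset (Fin n) := Finset.univ.filter fun x => (T x).1.2 = 0

theorem card_firstRow : T.firstRow.card = μ.rowLen 0 := by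
  rw [YoungDiagram.rowLen_eq_card]
  refine Finset.card_bij (fun x _ => (T x).1) (fun x hx => ?_)
    (fun x _ y _ h => T.injective (Subtype.ext h)) fun c hc => ?_
  · exact YoungDiagram.mem_row_iff.2 ⟨(T x).2, (Finset.mem_filter.1 hx).2⟩
  · obtain ⟨h1, h2⟩ := YoungDiagram.mem_row_iff.1 hc
    exact ⟨T.symm ⟨c, h1⟩, by simp [firstRow, h2], by simp⟩

theorem card_firstCol : T.firstCol.card = μ.colLen 0 := by
  rw [YoungDiagram.colLen_eq_card]
  refine Finset.card_bij (fun x _ => (T x).1) (fun x hx => ?_)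
    (fun x _ y _ h => T.injective (Subtype.ext h)) fun c hc => ?_
  · exact YoungDiagram.mem_col_iff.2 ⟨(T x).2, (Finset.mem_filter.1 hx).2⟩
  · obtain ⟨h1, h2⟩ := YoungDiagram.mem_col_iff.1 hc
    exact ⟨T.symm ⟨c, h1⟩, by simp [firstCol, h2], by simp⟩

variable {T}

theorem mem_rowGroup_of_fixes {σ : Equiv.Perm (Fin n)} (h : ∀ x ∉ T.firstRow, σ x = x) :
    σ ∈ T.rowGroup := by
  intro x
  by_cases hx : x ∈ T.firstRow
  · by_cases hσ : σ x ∈ T.firstRow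
    · rw [(Finset.mem_filter.1 hσ).2, (Finset.mem_filter.1 hx).2]
    · rw [σ.injective (h _ hσ)]
  · rw [h x hx]

theorem mem_colGroup_of_fixes {σ : Equiv.Perm (Fin n)} (h : ∀ x ∉ T.firstCol, σ x = x) :
    σ ∈ T.colGroup := by
  intro x
  by_cases hx : x ∈ T.firstCol
  · by_cases hσ : σ x ∈ T.firstCol
    · rw [(Finset.mem_filter.1 hσ).2, (Finset.mem_filter.1 hx).2]
    · rw [σ.injective (h _ hσ)]
  · rw [h x hx]

end YoungTableau

/-! ### Application to big representations -/

/-- If the permutations of a set `s` of letters act by a character on some vector of a big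
irreducible representation of `S_n`, then `s` has fewer than `4 √n log n` elements. -/
theorem Representation.lt_of_isBig_of_linearEquiv {n : ℕ} {V M : Type*} [AddCommGroup V]
    [Module ℂ V] [AddCommGroup M] [Module ℂ M] [Module (MonoidAlgebra ℂ (Equiv.Perm (Fin n))) M]
    [IsScalarTower ℂ (MonoidAlgebra ℂ (Equiv.Perm (Fin n))) M] [FiniteDimensional ℂ M]
    [IsSimpleModule (MonoidAlgebra ℂ (Equiv.Perm (Fin n))) M]
    (ρ : Representation ℂ (Equiv.Perm (Fin n)) V) (hbig : IsBig ρ)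
    (e : ρ.asModule ≃ₗ[MonoidAlgebra ℂ (Equiv.Perm (Fin n))] M) (s : Finset (Fin n))
    (χ : Equiv.Perm (Fin n) → ℂ) {m : M} (hm0 : m ≠ 0)
    (hm : ∀ σ : Equiv.Perm (Fin n), (∀ x ∉ s, σ x = x) →
      MonoidAlgebra.of ℂ (Equiv.Perm (Fin n)) σ • m = χ σ • m) :
    (s.card : ℝ) < 4 * √(n : ℝ) * Real.log n := by
  have hirr : ρ.IsIrreducible := by
    rw [Representation.irreducible_iff_isSimpleModule_asModule]
    exact IsSimpleModule.congr e
  have hfin : FiniteDimensional ℂ V :=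
    Module.Finite.equiv (e.restrictScalars ℂ).symm
  have hv : ∀ σ : Equiv.Perm (Fin n), (∀ x ∉ s, σ x = x) →
      ρ σ (e.symm m : ρ.asModule) = χ σ • (e.symm m : ρ.asModule) := by
    intro σ hσ
    have h := congrArg e.symm (hm σ hσ)
    rw [map_smul, MonoidAlgebra.of_apply, Representation.single_smul, one_smul] at h
    exact h.trans ((e.restrictScalars ℂ).symm.map_smul (χ σ) m)
  have hdim := Representation.IsIrreducible.finrank_le_choose_mul_sqrt ρ s χ
    (v := (e.symm m : ρ.asModule)) (fun h => hm0 (e.symm.map_eq_zero_iff.1 h)) hv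
  rw [Fintype.card_fin] at hdim
  exact lt_of_exp_neg_mul_sqrt_factorial_lt (by simpa using s.card_le_univ)
    (lt_of_lt_of_le hbig hdim)

theorem lemma7 {n : ℕ} {V : Type*} [AddCommGroup V] [Module ℂ V]
    (ρ : Representation ℂ (Equiv.Perm (Fin n)) V) (μ : YoungDiagram)
    (hμ : IsIrrepOfShape ρ μ) (hbig : IsBig ρ) :
    (μ.rowLen 0 : ℝ) < 4 * √(n : ℝ) * Real.log n ∧
      (μ.colLen 0 : ℝ) < 4 * √(n : ℝ) * Real.log n := by
  obtain ⟨T, ⟨e⟩⟩ := hμ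
  have hsimple := T.isSimpleModule_spechtModule
  have hfin : FiniteDimensional ℂ T.spechtModule :=
    inferInstanceAs (FiniteDimensional ℂ (T.spechtModule.restrictScalars ℂ))
  constructor
  · obtain ⟨v, hv0, hv⟩ := T.exists_rowGroup_fixed
    rw [← T.card_firstRow]
    refine ρ.lt_of_isBig_of_linearEquiv hbig e T.firstRow (fun _ => 1) hv0 fun σ hσ => ?_
    rw [hv σ (YoungTableau.mem_rowGroup_of_fixes hσ), one_smul]
  · obtain ⟨v, hv0, hv⟩ := T.exists_colGroup_sign
    rw [← T.card_firstCol]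
    exact ρ.lt_of_isBig_of_linearEquiv hbig e T.firstCol
      (fun σ => ((Equiv.Perm.sign σ : ℤ) : ℂ)) hv0
      fun σ hσ => hv σ (YoungTableau.mem_colGroup_of_fixes hσ)
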